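/- Let $d$ be a natural number and let $g\in L^2(\mathbb R^d)$ be a complex-valued function with $\|g\|_2=1$. For $f\in L^2(\mathbb R^d)$ and $z=(x,\xi)\in\mathbb R^d\times\mathbb R^d=\mathbb R^{2d}$ let $$V_gf(x,\xi)=\int_{\mathbb R^d} f(t)\,\overline{g(t-x)}\,e^{-2\pi i\,\xi\cdot t}\,dt ,$$ and assume that $g\in M^*(\mathbb R^d)$, that is, $$\|g\|_{M^*}^2:=\int_{\mathbb R^{2d}}|z|\,|V_gg(z)|^2\,dz<\infty ,$$ where $|z|$ is the Euclidean norm. Let $\Omega\subset\mathbb R^{2d}$ be a compact set of finite perimeter, that is, its characteristic function $1_\Omega$ has bounded variation; its perimeter is $$|\partial\Omega|:=\mathrm{Var}(1_\Omega)=\sup\Big\{\int_\Omega \operatorname{div}\phi(z)\,dz:\ \phi\in C^1_c(\mathbb R^{2d},\mathbb R^{2d}),\ |\phi(z)|\le 1 \text{ for all } z\Big\}<\infty .$$ Let $|\Omega|$ be the Lebesgue measure of $\Omega$, and let $H_\Omega:L^2(\mathbb R^d)\to L^2(\mathbb R^d)$ be the time-frequency localization operator $$H_\Omega f(t)=\int_\Omega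 V_gf(x,\xi)\,g(t-x)\,e^{2\pi i\,\xi\cdot t}\,dx\,d\xi .$$ Then, for each $\delta\in(0,1)$, the number $N$ of eigenvalues of $H_\Omega$ that are larger than $1-\delta$, counted with multiplicity, is finite and $$\big|\,N-|\Omega|\,\big|\le \max\Big\{\frac1\delta,\frac1{1-\delta}\Big\}\,\|g\|_{M^*}^2\,|\partial\Omega| .$$ -/

import Mathlib

open MeasureTheory Set
open scoped ENNReal Real ComplexConjugate

noncomputable section

/-- The variation `Var(f) = sup { ∫ f div φ : φ ∈ C¹_c(X, X), |φ| ≤ 1 } ∈ [0, ∞]` of a function on a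
Euclidean space. The divergence is the trace of the derivative; as `φ = 0` is allowed, truncating
negative values by `ENNReal.ofReal` does not change the supremum. -/
def variation {X : Type*} [NormedAddCommGroup X] [InnerProductSpace ℝ X] [FiniteDimensional ℝ X]
    [MeasurableSpace X] [BorelSpace X] (f : X → ℝ) : ℝ≥0∞ :=
  ⨆ φ ∈ {φ : X → X | ContDiff ℝ 1 φ ∧ HasCompactSupport φ ∧ ∀ x, ‖φ x‖ ≤ 1},
    ENNReal.ofReal (∫ x, f x * LinearMap.trace ℝ X (fderiv ℝ φ x).toLinearMap)

/-- Functions of bounded variation: integrable, with finite variation. -/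
def MemBV {X : Type*} [NormedAddCommGroup X] [InnerProductSpace ℝ X] [FiniteDimensional ℝ X]
    [MeasurableSpace X] [BorelSpace X] (f : X → ℝ) : Prop :=
  Integrable f ∧ variation f < ∞

/-- A set has finite perimeter if its characteristic function has bounded variation. -/
def HasFinitePerimeter {X : Type*} [NormedAddCommGroup X] [InnerProductSpace ℝ X]
    [FiniteDimensional ℝ X] [MeasurableSpace X] [BorelSpace X] (E : Set X) : Prop :=
  MemBV (E.indicator (fun _ => (1 : ℝ)))

/-- The perimeter of a set (meaningful for sets of finite perimeter): the variation of its
characteristic function. -/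
def perimeter {X : Type*} [NormedAddCommGroup X] [InnerProductSpace ℝ X] [FiniteDimensional ℝ X]
    [MeasurableSpace X] [BorelSpace X] (E : Set X) : ℝ :=
  (variation (E.indicator (fun _ => (1 : ℝ)))).toReal

/-- The space `L²(ℝᵈ)` of complex-valued functions. -/
abbrev L2 (d : ℕ) : Type := Lp ℂ 2 (volume : Measure (EuclideanSpace ℝ (Fin d)))

/-- Phase space `ℝ²ᵈ = ℝᵈ × ℝᵈ` with the Euclidean norm and Lebesgue measure; a point `z = (x, ξ)`
has `x = z.fst` and `ξ = z.snd`. -/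
abbrev PhaseSpace (d : ℕ) : Type :=
  WithLp 2 (EuclideanSpace ℝ (Fin d) × EuclideanSpace ℝ (Fin d))

/-- The short-time Fourier transform
`V_g f (x, ξ) = ∫ f(t) conj(g(t - x)) exp(-2πi ξ·t) dt`. -/
def stft {d : ℕ} (g f : L2 d) (z : PhaseSpace d) : ℂ :=
  ∫ t : EuclideanSpace ℝ (Fin d),
    f t * conj (g (t - z.fst)) * Complex.exp (-2 * π * Complex.I * (inner ℝ z.snd t : ℝ))

/-- The integral `∫ |z| |V_g g(z)|² dz ∈ [0, ∞]`. -/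
def mStarIntegral {d : ℕ} (g : L2 d) : ℝ≥0∞ :=
  ∫⁻ z : PhaseSpace d, ‖z‖ₑ * ‖stft g g z‖ₑ ^ 2

/-- The class `M*(ℝᵈ)`. -/
def MemMStar {d : ℕ} (g : L2 d) : Prop := mStarIntegral g < ∞

/-- `‖g‖_{M*} = (∫ |z| |V_g g(z)|² dz)^{1/2}` (meaningful for `g ∈ M*`). -/
def mStarNorm {d : ℕ} (g : L2 d) : ℝ := √(mStarIntegral g).toReal

/-- The function
`t ↦ ∫_Ω V_g f(x, ξ) g(t - x) exp(2πi ξ·t) dx dξ`. -/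
def locFun {d : ℕ} (g : L2 d) (Ω : Set (PhaseSpace d)) (f : L2 d)
    (t : EuclideanSpace ℝ (Fin d)) : ℂ :=
  ∫ z in Ω, stft g f z * g (t - z.fst) *
    Complex.exp (2 * π * Complex.I * (inner ℝ z.snd t : ℝ))

theorem norm_cexp_two_pi (s : ℝ) : ‖Complex.exp (2 * π * Complex.I * (s : ℂ))‖ = 1 := by
  have h : (2 * π * Complex.I * (s : ℂ)) = ((2 * π * s : ℝ) : ℂ) * Complex.I := by
    push_cast; ring
  rw [h, Complex.norm_exp_ofReal_mul_I]

theorem norm_cexp_neg_two_pi (s : ℝ) : ‖Complex.exp (-2 * π * Complex.I * (s : ℂ))‖ = 1 := by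
  have h : (-2 * π * Complex.I * (s : ℂ)) = ((-2 * π * s : ℝ) : ℂ) * Complex.I := by
    push_cast; ring
  rw [h, Complex.norm_exp_ofReal_mul_I]

theorem memLp_shift {d : ℕ} (g : L2 d) (x : EuclideanSpace ℝ (Fin d)) :
    MemLp (fun t => g (t - x)) 2 volume :=
  (Lp.memLp g).comp_measurePreserving (measurePreserving_sub_right volume x)

theorem integrable_stft {d : ℕ} (g f : L2 d) (z : PhaseSpace d) :
    Integrable (fun t : EuclideanSpace ℝ (Fin d) => f t * conj (g (t - z.fst)) *
      Complex.exp (-2 * π * Complex.I * (inner ℝ z.snd t : ℝ))) := by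
  have h1 : Integrable (fun t => f t * conj (g (t - z.fst))) :=
    (Lp.memLp f).integrable_mul (memLp_shift g z.fst).star
  refine h1.mul_bdd (c := 1) ?_ ?_
  · exact (by fun_prop : Continuous fun t : EuclideanSpace ℝ (Fin d) =>
      Complex.exp (-2 * π * Complex.I * (inner ℝ z.snd t : ℝ))).aestronglyMeasurable
  · exact Filter.Eventually.of_forall fun t => (norm_cexp_neg_two_pi _).le

theorem stft_add {d : ℕ} (g f₁ f₂ : L2 d) (z : PhaseSpace d) :
    stft g (f₁ + f₂) z = stft g f₁ z + stft g f₂ z := by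
  unfold stft
  rw [← integral_add (integrable_stft g f₁ z) (integrable_stft g f₂ z)]
  refine integral_congr_ae ?_
  filter_upwards [Lp.coeFn_add f₁ f₂] with t ht
  rw [ht, Pi.add_apply]; ring

theorem stft_smul {d : ℕ} (g f : L2 d) (c : ℂ) (z : PhaseSpace d) :
    stft g (c • f) z = c * stft g f z := by
  unfold stft
  rw [← integral_const_mul]
  refine integral_congr_ae ?_
  filter_upwards [Lp.coeFn_smul c f] with t ht
  rw [ht, Pi.smul_apply, smul_eq_mul]; ring

theorem stronglyMeasurable_stft {d : ℕ} (g f : L2 d) : StronglyMeasurable (stft g f) := by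
  unfold stft
  refine StronglyMeasurable.integral_prod_right (f := fun (z : PhaseSpace d)
    (t : EuclideanSpace ℝ (Fin d)) => f t * conj (g (t - z.fst)) *
      Complex.exp (-2 * π * Complex.I * (inner ℝ z.snd t : ℝ))) ?_
  have hf := (Lp.stronglyMeasurable f).measurable
  have hg := (Lp.stronglyMeasurable g).measurable
  have hc : Measurable (fun p : PhaseSpace d × EuclideanSpace ℝ (Fin d) =>
      Complex.exp (-2 * π * Complex.I * (inner ℝ p.1.snd p.2 : ℝ))) :=
    (by fun_prop : Continuous fun p : PhaseSpace d × EuclideanSpace ℝ (Fin d) =>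
      Complex.exp (-2 * π * Complex.I * (inner ℝ p.1.snd p.2 : ℝ))).measurable
  have hs : Measurable (fun p : PhaseSpace d × EuclideanSpace ℝ (Fin d) => p.2 - p.1.fst) :=
    (by fun_prop : Continuous fun p : PhaseSpace d × EuclideanSpace ℝ (Fin d) =>
      p.2 - p.1.fst).measurable
  exact (((hf.comp measurable_snd).mul
    (Complex.continuous_conj.measurable.comp (hg.comp hs))).mul hc).stronglyMeasurable

theorem exists_enorm_stft_le {d : ℕ} (g f : L2 d) :
    ∃ C : ℝ≥0∞, C ≠ ∞ ∧ ∀ z, ‖stft g f z‖ₑ ≤ C := by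
  refine ⟨eLpNorm f 2 volume * eLpNorm g 2 volume,
    ENNReal.mul_ne_top (Lp.eLpNorm_ne_top f) (Lp.eLpNorm_ne_top g), fun z => ?_⟩
  have hsh : eLpNorm (fun t => g (t - z.fst)) 2 volume = eLpNorm g 2 volume :=
    eLpNorm_comp_measurePreserving (Lp.aestronglyMeasurable g)
      (measurePreserving_sub_right volume z.fst)
  calc ‖stft g f z‖ₑ
      ≤ ∫⁻ t, ‖f t * conj (g (t - z.fst)) *
          Complex.exp (-2 * π * Complex.I * (inner ℝ z.snd t : ℝ))‖ₑ :=
        enorm_integral_le_lintegral_enorm _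
    _ = ∫⁻ t, ‖f t‖ₑ * ‖g (t - z.fst)‖ₑ := by
        refine lintegral_congr fun t => ?_
        rw [enorm_mul, enorm_mul, ← ofReal_norm (Complex.exp _), norm_cexp_neg_two_pi,
          ← ofReal_norm (conj (g (t - z.fst))), RCLike.norm_conj, ofReal_norm]
        simp
    _ ≤ eLpNorm f 2 volume * eLpNorm (fun t => g (t - z.fst)) 2 volume := by
        have h := ENNReal.lintegral_mul_le_Lp_mul_Lq volume Real.HolderConjugate.two_two
          (Lp.aestronglyMeasurable f).enorm (memLp_shift g z.fst).1.enorm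
        simpa [eLpNorm_eq_lintegral_rpow_enorm_toReal] using h
    _ = _ := by rw [hsh]

theorem measurable_locFun_integrand {d : ℕ} (g f : L2 d) :
    Measurable (fun p : EuclideanSpace ℝ (Fin d) × PhaseSpace d =>
      stft g f p.2 * g (p.1 - p.2.fst) *
        Complex.exp (2 * π * Complex.I * (inner ℝ p.2.snd p.1 : ℝ))) := by
  have hg := (Lp.stronglyMeasurable g).measurable
  have hv := (stronglyMeasurable_stft g f).measurable
  have hc : Measurable (fun p : EuclideanSpace ℝ (Fin d) × PhaseSpace d =>
      Complex.exp (2 * π * Complex.I * (inner ℝ p.2.snd p.1 : ℝ))) :=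
    (by fun_prop : Continuous fun p : EuclideanSpace ℝ (Fin d) × PhaseSpace d =>
      Complex.exp (2 * π * Complex.I * (inner ℝ p.2.snd p.1 : ℝ))).measurable
  have hs : Measurable (fun p : EuclideanSpace ℝ (Fin d) × PhaseSpace d => p.1 - p.2.fst) :=
    (by fun_prop : Continuous fun p : EuclideanSpace ℝ (Fin d) × PhaseSpace d =>
      p.1 - p.2.fst).measurable
  exact ((hv.comp measurable_snd).mul (hg.comp hs)).mul hc

theorem lintegral_locFun_integrand_lt_top {d : ℕ} (g f : L2 d) {Ω : Set (PhaseSpace d)}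
    (hΩ : IsCompact Ω) :
    ∫⁻ t : EuclideanSpace ℝ (Fin d), ∫⁻ z in Ω, ‖stft g f z * g (t - z.fst) *
        Complex.exp (2 * π * Complex.I * (inner ℝ z.snd t : ℝ))‖ₑ ^ (2 : ℝ) < ∞ := by
  obtain ⟨C, hC, hb⟩ := exists_enorm_stft_le g f
  rw [lintegral_lintegral_swap (((measurable_locFun_integrand g f).enorm.pow_const
    (2 : ℝ)).aemeasurable)]
  have hfin : ∫⁻ t, ‖g t‖ₑ ^ (2 : ℝ) < ∞ := by
    have h := lintegral_rpow_enorm_lt_top_of_eLpNorm_lt_top (p := 2) (by simp) (by simp)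
      (Lp.eLpNorm_lt_top g)
    simpa using h
  have hle : ∀ z : PhaseSpace d, ∫⁻ t : EuclideanSpace ℝ (Fin d), ‖stft g f z * g (t - z.fst) *
        Complex.exp (2 * π * Complex.I * (inner ℝ z.snd t : ℝ))‖ₑ ^ (2 : ℝ)
      ≤ C ^ (2 : ℝ) * ∫⁻ t, ‖g t‖ₑ ^ (2 : ℝ) := fun z => by
    calc _ ≤ ∫⁻ t, C ^ (2 : ℝ) * ‖g (t - z.fst)‖ₑ ^ (2 : ℝ) := by
          refine lintegral_mono fun t => ?_
          rw [enorm_mul, enorm_mul, ← ofReal_norm (Complex.exp _), norm_cexp_two_pi,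
            ENNReal.ofReal_one, mul_one, ENNReal.mul_rpow_of_nonneg _ _ (by norm_num)]
          gcongr
          exact hb z
      _ = C ^ (2 : ℝ) * ∫⁻ t, ‖g (t - z.fst)‖ₑ ^ (2 : ℝ) :=
          lintegral_const_mul' _ _ (ENNReal.rpow_ne_top_of_nonneg (by norm_num) hC)
      _ = _ := by rw [lintegral_sub_right_eq_self (fun t => ‖g t‖ₑ ^ (2 : ℝ)) z.fst]
  refine (lintegral_mono hle).trans_lt ?_
  rw [setLIntegral_const]
  exact ENNReal.mul_lt_top (ENNReal.mul_lt_top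
    (ENNReal.rpow_lt_top_of_nonneg (by norm_num) hC) hfin) hΩ.measure_lt_top

theorem ae_integrable_locFun {d : ℕ} (g f : L2 d) {Ω : Set (PhaseSpace d)} (hΩ : IsCompact Ω) :
    ∀ᵐ t : EuclideanSpace ℝ (Fin d), IntegrableOn (fun z : PhaseSpace d =>
      stft g f z * g (t - z.fst) *
        Complex.exp (2 * π * Complex.I * (inner ℝ z.snd t : ℝ))) Ω := by
  have : IsFiniteMeasure (volume.restrict Ω) := ⟨by simpa using hΩ.measure_lt_top⟩
  have hm := measurable_locFun_integrand g f
  have := ae_lt_top (hm.enorm.pow_const (2 : ℝ)).lintegral_prod_right'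
    (lintegral_locFun_integrand_lt_top g f hΩ).ne
  filter_upwards [this] with t ht
  have hmt := hm.comp (measurable_prodMk_left (x := t))
  have h2 : MemLp (fun z : PhaseSpace d => stft g f z * g (t - z.fst) *
        Complex.exp (2 * π * Complex.I * (inner ℝ z.snd t : ℝ))) 2 (volume.restrict Ω) := by
    refine ⟨hmt.aestronglyMeasurable, ?_⟩
    rw [eLpNorm_lt_top_iff_lintegral_rpow_enorm_lt_top (by simp) (by simp)]
    simpa using ht
  exact h2.integrable (by norm_num)

theorem memLp_locFun {d : ℕ} (g : L2 d) {Ω : Set (PhaseSpace d)} (hΩ : IsCompact Ω) (f : L2 d) :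
    MemLp (locFun g Ω f) 2 volume := by
  have hm := measurable_locFun_integrand g f
  refine ⟨(StronglyMeasurable.integral_prod_right' (ν := volume.restrict Ω)
    hm.stronglyMeasurable).aestronglyMeasurable, ?_⟩
  rw [eLpNorm_lt_top_iff_lintegral_rpow_enorm_lt_top (by simp) (by simp)]
  refine lt_of_le_of_lt (lintegral_mono (g := fun t => volume Ω * ∫⁻ z in Ω,
    ‖stft g f z * g (t - z.fst) *
      Complex.exp (2 * π * Complex.I * (inner ℝ z.snd t : ℝ))‖ₑ ^ (2 : ℝ)) fun t => ?_) ?_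
  · have hmt := (hm.comp (measurable_prodMk_left (x := t))).enorm
    have hcs := ENNReal.lintegral_mul_le_Lp_mul_Lq (volume.restrict Ω)
      Real.HolderConjugate.two_two (aemeasurable_const (b := (1 : ℝ≥0∞))) hmt.aemeasurable
    simp only [Pi.mul_apply, one_mul, ENNReal.one_rpow, lintegral_const,
      Measure.restrict_apply_univ] at hcs
    calc ‖locFun g Ω f t‖ₑ ^ (2 : ℝ≥0∞).toReal
        ≤ (volume Ω ^ (1 / (2 : ℝ)) * (∫⁻ z in Ω, ‖stft g f z * g (t - z.fst) *
          Complex.exp (2 * π * Complex.I * (inner ℝ z.snd t : ℝ))‖ₑ ^ (2 : ℝ)) ^ (1 / (2 : ℝ)))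
            ^ (2 : ℝ) := by
          rw [ENNReal.toReal_ofNat]
          gcongr
          exact (enorm_integral_le_lintegral_enorm _).trans hcs
      _ = _ := by
          rw [ENNReal.mul_rpow_of_nonneg _ _ (by norm_num), ← ENNReal.rpow_mul,
            ← ENNReal.rpow_mul]
          norm_num
  · rw [lintegral_const_mul' _ _ hΩ.measure_lt_top.ne]
    exact ENNReal.mul_lt_top hΩ.measure_lt_top (lintegral_locFun_integrand_lt_top g f hΩ)

/-- The time-frequency localization operator `H_Ω : L²(ℝᵈ) → L²(ℝᵈ)` with window `g`. -/
def locOp {d : ℕ} (g : L2 d) (Ω : Set (PhaseSpace d)) (hΩ : IsCompact Ω) : L2 d →ₗ[ℂ] L2 d where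
  toFun f := (memLp_locFun g hΩ f).toLp (locFun g Ω f)
  map_add' f₁ f₂ := by
    rw [← MemLp.toLp_add]
    refine MemLp.toLp_congr _ _ ?_
    filter_upwards [ae_integrable_locFun g f₁ hΩ, ae_integrable_locFun g f₂ hΩ] with t h₁ h₂
    rw [Pi.add_apply]
    unfold locFun
    rw [← integral_add h₁ h₂]
    simp only [stft_add, add_mul]
  map_smul' c f := by
    rw [RingHom.id_apply, ← MemLp.toLp_const_smul]
    refine MemLp.toLp_congr _ _ (Filter.Eventually.of_forall fun t => ?_)
    rw [Pi.smul_apply, smul_eq_mul]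
    unfold locFun
    rw [← integral_const_mul]
    simp only [stft_smul, mul_assoc]

/-- The number of eigenvalues of `T` that are larger than `a`, counted with multiplicity: the
dimension of the sum of the eigenspaces `ker (T - μ)`, `μ > a`. This sum is direct, so this is
`∑_{μ > a} dim ker (T - μ)`, an element of `ℕ ∪ {∞}`. -/
def eigenvalueCount {V : Type*} [AddCommGroup V] [Module ℂ V] (T : V →ₗ[ℂ] V) (a : ℝ) : ℕ∞ :=
  Cardinal.toENat (Module.rank ℂ
    (⨆ μ ∈ Set.Ioi a, Module.End.eigenspace T (μ : ℂ) : Submodule ℂ V))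

end

/-! Write `π(z)g` for the time-frequency shift of `g`, a unit vector with `V_g f(z) = ⟨π(z)g, f⟩`.
In weak form `⟨h, H_Ω f⟩ = ∫_Ω conj(V_g h) V_g f`, so Moyal's identity makes `H_Ω` symmetric with `0
≤ H_Ω ≤ 1`. It is Hilbert-Schmidt, hence has an eigenbasis `b i` with eigenvalues `l i = ∫_Ω |V_g (b
i)|²` in `[0, 1]`.

Two trace computations follow from Parseval applied to `π(z)g`. Integrating `∑ |V_g (b i)(z)|² = 1`
over `Ω` gives `∑ l i = |Ω|`. Integrating `∑ l i |V_g (b i)(z)|² = ⟨π(z)g, H_Ω π(z)g⟩ = ∫_Ω |V_g g(w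
- z)|² dw` gives `∑ (l i)²`. As `∫ |V_g g|² = 1`, Tonelli yields `∑ (l i - (l i)²) = ∫ |V_g g(u)|²
|{z ∈ Ω : z + u ∉ Ω}| du`.

A set of finite perimeter loses at most `|u| |∂Ω|` of its measure under translation by `u`
(`volume_diff_translate_le`), so this sum is at most `‖g‖_{M*}² |∂Ω|`. Finally `N = ∑ 1_{l i > 1 -
δ}`, and this indicator differs from `l i` by at most `max (1/δ) (1/(1-δ))` times `l i - (l i)²`. -/

noncomputable section

/-! ### Plancherel on `L¹ ∩ L²` -/

open scoped FourierTransform SchwartzMap in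
/-- The Fourier transform on `L²` is given by the Fourier integral on integrable functions. -/
theorem fourier_toLp_ae_eq {E : Type*} [NormedAddCommGroup E] [InnerProductSpace ℝ E]
    [FiniteDimensional ℝ E] [MeasurableSpace E] [BorelSpace E] {F : E → ℂ}
    (h1 : Integrable F) (h2 : MemLp F 2) :
    (𝓕 (h2.toLp F) : Lp ℂ 2 (volume : Measure E)) =ᵐ[volume] 𝓕 F := by
  refine ae_eq_of_integral_contDiff_smul_eq
    ((Lp.memLp _).locallyIntegrable (by norm_num)) ?_ ?_
  · have hc : Continuous (𝓕 F) := VectorFourier.fourierIntegral_continuous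
      Real.continuous_fourierChar (innerSL ℝ).continuous₂ h1
    exact hc.locallyIntegrable
  · intro φ hφ hφc
    have hφ' : ContDiff ℝ ((⊤ : ℕ∞) : WithTop ℕ∞) (fun x => (φ x : ℂ)) :=
      Complex.ofRealCLM.contDiff.comp hφ
    have hφc' : HasCompactSupport (fun x => (φ x : ℂ)) := hφc.comp_left (g := Complex.ofReal) rfl
    let φ' : 𝓢(E, ℂ) := hφc'.toSchwartzMap hφ'
    have hφ'c : ∀ x, φ' x = (φ x : ℂ) := fun x => rfl
    -- Tested against `φ'`, the `L²` transform is the distributional one, so the transform moves to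
    -- `φ'`; `e3` moves it back onto the integrable `F` by the multiplication formula.
    have e1 : ∫ x, φ' x • (𝓕 (h2.toLp F) : Lp ℂ 2 (volume : Measure E)) x =
        ∫ x, (𝓕 φ') x • (h2.toLp F) x := by
      rw [← Lp.toTemperedDistribution_apply, ← Lp.fourier_toTemperedDistribution_eq,
        TemperedDistribution.fourier_apply, Lp.toTemperedDistribution_apply]
    have e2 : ∫ x, (𝓕 φ') x • (h2.toLp F) x = ∫ x, (𝓕 φ') x • F x := by
      refine integral_congr_ae ?_
      filter_upwards [h2.coeFn_toLp] with x hx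
      rw [hx]
    have e3 : ∫ x, (𝓕 φ') x • F x = ∫ x, φ' x • 𝓕 F x := by
      have := VectorFourier.integral_fourierIntegral_smul_eq_flip (L := innerₗ E)
        (μ := volume) (ν := volume) (f := φ') (g := F)
        Real.continuous_fourierChar continuous_inner φ'.integrable h1
      rw [flip_innerₗ] at this
      exact this
    rw [e2, e3] at e1
    simpa [hφ'c] using e1

open scoped FourierTransform in
/-- **Plancherel's theorem** for functions in `L¹ ∩ L²`. -/
theorem lintegral_enorm_fourier_sq {E : Type*} [NormedAddCommGroup E] [InnerProductSpace ℝ E]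
    [FiniteDimensional ℝ E] [MeasurableSpace E] [BorelSpace E] {F : E → ℂ}
    (h1 : Integrable F) (h2 : MemLp F 2) :
    ∫⁻ ξ, ‖𝓕 F ξ‖ₑ ^ 2 = ∫⁻ t, ‖F t‖ₑ ^ 2 := by
  have key : eLpNorm (𝓕 F) 2 volume = eLpNorm F 2 volume := by
    rw [← eLpNorm_congr_ae (fourier_toLp_ae_eq h1 h2), ← eLpNorm_congr_ae h2.coeFn_toLp,
      ← Lp.enorm_def, ← Lp.enorm_def, ← ofReal_norm, ← ofReal_norm, Lp.norm_fourier_eq]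
  have h := congrArg (· ^ (2 : ℝ)) key
  simp only [eLpNorm_eq_lintegral_rpow_enorm_toReal (p := 2) (by simp) (by simp)] at h
  rw [← ENNReal.rpow_mul, ← ENNReal.rpow_mul] at h
  simpa using h

/-! ### Functions of bounded variation under translation -/

section Translation

variable {X : Type*} [NormedAddCommGroup X] [InnerProductSpace ℝ X] [FiniteDimensional ℝ X]
  [MeasurableSpace X] [BorelSpace X]

theorem integral_mul_trace_fderiv_le_variation {f : X → ℝ} (hf : variation f ≠ ∞)
    {φ : X → X} (h1 : ContDiff ℝ 1 φ) (h2 : HasCompactSupport φ) (h3 : ∀ x, ‖φ x‖ ≤ 1) :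
    ∫ x, f x * LinearMap.trace ℝ X (fderiv ℝ φ x).toLinearMap ≤ (variation f).toReal := by
  have : ENNReal.ofReal (∫ x, f x * LinearMap.trace ℝ X (fderiv ℝ φ x).toLinearMap)
      ≤ variation f :=
    le_iSup₂ (f := fun (φ : X → X) (_ : φ ∈ {φ : X → X | ContDiff ℝ 1 φ ∧ HasCompactSupport φ ∧
      ∀ x, ‖φ x‖ ≤ 1}) => ENNReal.ofReal
        (∫ x, f x * LinearMap.trace ℝ X (fderiv ℝ φ x).toLinearMap)) φ ⟨h1, h2, h3⟩
  exact (ENNReal.ofReal_le_iff_le_toReal hf).1 this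

/-- The directional derivative of a test function, tested against `f`. -/
theorem integral_mul_fderiv_le_variation {f : X → ℝ} (hf : variation f ≠ ∞)
    {ψ : X → ℝ} (h1 : ContDiff ℝ 1 ψ) (h2 : HasCompactSupport ψ) (h3 : ∀ x, ‖ψ x‖ ≤ 1) (v : X) :
    ∫ x, f x * fderiv ℝ ψ x v ≤ ‖v‖ * (variation f).toReal := by
  rcases eq_or_ne v 0 with rfl | hv
  · simp
  have hv' : 0 < ‖v‖ := norm_pos_iff.2 hv
  -- The admissible field is `ψ w` with `w` a unit vector; its divergence is the derivative of `ψ`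
  -- along `w`.
  let w : X := ‖v‖⁻¹ • v
  have hw : ‖w‖ = 1 := by simp [w, norm_smul, hv'.ne']
  have hd : ∀ x, LinearMap.trace ℝ X (fderiv ℝ (fun x => ψ x • w) x).toLinearMap
      = ‖v‖⁻¹ * fderiv ℝ ψ x v := fun x => by
    have : fderiv ℝ (fun x => ψ x • w) x = (fderiv ℝ ψ x).smulRight w :=
      ((h1.differentiable (by norm_num) x).hasFDerivAt.smul_const w).fderiv
    rw [this]
    have e : ((fderiv ℝ ψ x).smulRight w).toLinearMap
      = ((fderiv ℝ ψ x).toLinearMap).smulRight w := rfl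
    rw [e, LinearMap.trace_smulRight]
    simp [w]
  have := integral_mul_trace_fderiv_le_variation hf (φ := fun x => ψ x • w)
    (h1.smul contDiff_const) h2.smul_right (fun x => by rw [norm_smul, hw, mul_one]; exact h3 x)
  simp only [hd] at this
  have e : ∀ x, f x * (‖v‖⁻¹ * fderiv ℝ ψ x v) = ‖v‖⁻¹ * (f x * fderiv ℝ ψ x v) :=
    fun x => by ring
  simp only [e, integral_const_mul] at this
  rwa [inv_mul_le_iff₀ hv'] at this

/-- Mean value inequality for `s ↦ ∫ f(x) ψ(x - su) dx` on `[0, 1]`: its derivative tests `f`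
against the derivative along `-u` of a translate of `ψ`, again an admissible test function. -/
theorem integral_mul_translate_sub_le {f : X → ℝ} (hfi : Integrable f) (hf : variation f ≠ ∞)
    {ψ : X → ℝ} (h1 : ContDiff ℝ 1 ψ) (h2 : HasCompactSupport ψ) (h3 : ∀ x, ‖ψ x‖ ≤ 1) (u : X) :
    ∫ x, f x * (ψ (x - u) - ψ x) ≤ ‖u‖ * (variation f).toReal := by
  obtain ⟨C, hC⟩ := (h2.fderiv (𝕜 := ℝ)).exists_bound_of_continuous
    (h1.continuous_fderiv (by norm_num))
  have hψi : ∀ s : ℝ, Integrable (fun x => f x * ψ (x - s • u)) := fun s =>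
    hfi.mul_bdd (c := 1) (by
      have := h1.continuous
      exact (by fun_prop : Continuous fun x => ψ (x - s • u)).aestronglyMeasurable)
      (Filter.Eventually.of_forall fun x => h3 _)
  have hder : ∀ s : ℝ, HasDerivAt (fun s : ℝ => ∫ x, f x * ψ (x - s • u))
      (∫ x, f x * fderiv ℝ ψ (x - s • u) (-u)) s := fun s => by
    refine (hasDerivAt_integral_of_dominated_loc_of_deriv_le (Metric.ball_mem_nhds s one_pos)
      (F' := fun s x => f x * fderiv ℝ ψ (x - s • u) (-u))
      (bound := fun x => ‖f x‖ * (C * ‖u‖))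
      (Filter.Eventually.of_forall fun s => (hψi s).aestronglyMeasurable) (hψi s) ?_ ?_ ?_ ?_).2
    · refine hfi.aestronglyMeasurable.mul (Continuous.aestronglyMeasurable ?_)
      have := h1.continuous_fderiv (by norm_num)
      fun_prop
    · refine Filter.Eventually.of_forall fun x s _ => ?_
      rw [norm_mul]
      gcongr
      refine (ContinuousLinearMap.le_opNorm _ _).trans ?_
      rw [norm_neg]
      gcongr
      exact hC _
    · exact hfi.norm.mul_const _
    · refine Filter.Eventually.of_forall fun x s _ => ?_
      have hin : HasDerivAt (fun s : ℝ => x - s • u) (-u) s := by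
        simpa using ((hasDerivAt_id s).smul_const u).const_sub x
      exact ((h1.differentiable (by norm_num) (x - s • u)).hasFDerivAt.comp_hasDerivAt s
        hin).const_mul (f x)
  have hle : ∀ s : ℝ, ∫ x, f x * fderiv ℝ ψ (x - s • u) (-u) ≤ ‖u‖ * (variation f).toReal :=
    fun s => by
      have := integral_mul_fderiv_le_variation hf (ψ := fun x => ψ (x - s • u))
        (h1.comp (contDiff_id.sub contDiff_const))
        (h2.comp_homeomorph (Homeomorph.subRight (s • u))) (fun x => h3 _) (-u)
      simpa only [fderiv_comp_sub, norm_neg] using this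
  have hmv := image_sub_le_mul_sub_of_deriv_le
    (f := fun s : ℝ => ∫ x, f x * ψ (x - s • u)) (fun s => (hder s).differentiableAt)
    (C := ‖u‖ * (variation f).toReal) (fun s => by rw [(hder s).deriv]; exact hle s)
    zero_le_one
  simp only [one_smul, zero_smul, sub_zero, mul_one] at hmv
  have h0 := hψi 0
  have h1' := hψi 1
  simp only [one_smul, zero_smul, sub_zero] at h0 h1'
  rw [← integral_sub h1' h0] at hmv
  simpa only [mul_sub] using hmv

theorem integral_translate_sub_mul_le {f : X → ℝ} (hfi : Integrable f) (hf : variation f ≠ ∞)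
    {ψ : X → ℝ} (h1 : ContDiff ℝ 1 ψ) (h2 : HasCompactSupport ψ) (h3 : ∀ x, ‖ψ x‖ ≤ 1) (u : X) :
    ∫ x, (f (x + u) - f x) * ψ x ≤ ‖u‖ * (variation f).toReal := by
  have hb : ∀ {k : X → ℝ}, Integrable k → ∀ v : X, Integrable (fun x => k x * ψ (x - v)) :=
    fun hk v => hk.mul_bdd (c := 1) (by
      have := h1.continuous
      exact (by fun_prop : Continuous fun x => ψ (x - v)).aestronglyMeasurable)
      (Filter.Eventually.of_forall fun x => h3 _)
  have hb0 : ∀ {k : X → ℝ}, Integrable k → Integrable (fun x => k x * ψ x) := fun hk => by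
    simpa using hb hk 0
  calc ∫ x, (f (x + u) - f x) * ψ x
      = (∫ x, f (x + u) * ψ x) - ∫ x, f x * ψ x := by
        simp only [sub_mul]
        exact integral_sub (hb0 (hfi.comp_add_right u)) (hb0 hfi)
    _ = (∫ x, f x * ψ (x - u)) - ∫ x, f x * ψ x := by
        rw [← integral_add_right_eq_self (fun x => f x * ψ (x - u)) u]
        simp
    _ = ∫ x, f x * (ψ (x - u) - ψ x) := by
        simp only [mul_sub]
        rw [integral_sub (hb hfi u) (hb0 hfi)]
    _ ≤ _ := integral_mul_translate_sub_le hfi hf h1 h2 h3 u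

-- The optimal test function for the difference `F` would be its sign. For indicators `F` takes the
-- values `-1, 0, 1` and is its own sign, so mollifications of `F` serve as test functions and
-- converge to it almost everywhere.
open scoped Convolution in
theorem integral_translate_sub_sq_le {f : X → ℝ} (hfi : Integrable f) (hfc : HasCompactSupport f)
    (hf : variation f ≠ ∞) (hf01 : ∀ x, f x ∈ Icc (0 : ℝ) 1) (u : X) :
    ∫ x, (f (x + u) - f x) ^ 2 ≤ ‖u‖ * (variation f).toReal := by
  set F : X → ℝ := fun x => f (x + u) - f x with hF
  have hFi : Integrable F := (hfi.comp_add_right u).sub hfi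
  have hFc : HasCompactSupport F := (hfc.comp_homeomorph (Homeomorph.addRight u)).sub hfc
  have hF1 : ∀ x, ‖F x‖ ≤ 1 := fun x => by
    have h1 := hf01 (x + u); have h2 := hf01 x
    rw [Real.norm_eq_abs, abs_le]
    constructor <;> simp only [hF] <;> linarith [h1.1, h1.2, h2.1, h2.2]
  -- The ratio 2 of outer to inner radius stays fixed, as the almost everywhere convergence of the
  -- mollifications requires.
  let b : ℕ → ContDiffBump (0 : X) := fun n =>
    ⟨1 / (n + 1), 2 / (n + 1), by positivity, by gcongr; norm_num⟩
  have hlim : Filter.Tendsto (fun n => (b n).rOut) Filter.atTop (nhds 0) := by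
    simpa [b, div_eq_mul_inv] using (tendsto_one_div_add_atTop_nhds_zero_nat (𝕜 := ℝ)).const_mul 2
  let G : ℕ → X → ℝ := fun n => (b n).normed volume ⋆[ContinuousLinearMap.lsmul ℝ ℝ] F
  have hG1 : ∀ n x, ‖G n x‖ ≤ 1 := fun n x => by
    have := dist_convolution_le
      (f := (b n).normed volume) (μ := volume) (g := F) (x₀ := x) (z₀ := (0 : ℝ))
      (ε := 1) zero_le_one
      (b n).support_normed_eq.subset (b n).nonneg_normed (b n).integral_normed
      hFi.aestronglyMeasurable (fun y _ => by simpa using hF1 y)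
    simpa using this
  have hGs : ∀ n, ContDiff ℝ 1 (G n) := fun n => by
    exact_mod_cast (b n).hasCompactSupport_normed.contDiff_convolution_left (n := 1) _
      ((b n).contDiff_normed) hFi.locallyIntegrable
  have hGc : ∀ n, HasCompactSupport (G n) := fun n =>
    HasCompactSupport.convolution _ (b n).hasCompactSupport_normed hFc
  have hae := ContDiffBump.ae_convolution_tendsto_right_of_locallyIntegrable (φ := b) (K := 2)
    (μ := volume) (g := F) hlim (Filter.Eventually.of_forall fun n => by
      simp only [b]; apply le_of_eq; ring) hFi.locallyIntegrable
  have hconv : Filter.Tendsto (fun n => ∫ x, F x * G n x) Filter.atTop (nhds (∫ x, F x ^ 2)) := by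
    refine tendsto_integral_of_dominated_convergence (fun x => ‖F x‖) (fun n => ?_) hFi.norm
      (fun n => Filter.Eventually.of_forall fun x => ?_) ?_
    · exact hFi.aestronglyMeasurable.mul (hGs n).continuous.aestronglyMeasurable
    · rw [norm_mul]; exact mul_le_of_le_one_right (norm_nonneg _) (hG1 n x)
    · filter_upwards [hae] with x hx
      rw [pow_two]
      exact hx.const_mul (F x)
  exact le_of_tendsto' hconv fun n =>
    integral_translate_sub_mul_le hfi hf (hGs n) (hGc n) (hG1 n) u

/-- For a compact set of finite perimeter, the measure of the points that leave the set under a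
translation is at most the length of the translation times the perimeter. -/
theorem volume_diff_translate_le {Ω : Set X} (hΩ : IsCompact Ω) (hp : HasFinitePerimeter Ω)
    (u : X) : volume {x | x ∈ Ω ∧ x + u ∉ Ω} ≤ ‖u‖ₑ * ENNReal.ofReal (perimeter Ω) := by
  have hfc : HasCompactSupport (Ω.indicator fun _ => (1 : ℝ)) :=
    HasCompactSupport.intro hΩ fun x hx => indicator_of_notMem hx _
  have h01 : ∀ x, Ω.indicator (fun _ => (1 : ℝ)) x ∈ Icc (0 : ℝ) 1 := fun x => by
    by_cases hx : x ∈ Ω <;> simp [hx]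
  have key := integral_translate_sub_sq_le hp.1 hfc hp.2.ne h01 u
  have hmeas : MeasurableSet {x | x ∈ Ω ∧ x + u ∉ Ω} :=
    hΩ.measurableSet.inter ((hΩ.measurableSet.preimage (measurable_add_const u)).compl)
  have hfin : volume {x | x ∈ Ω ∧ x + u ∉ Ω} ≠ ∞ :=
    ((measure_mono fun x hx => hx.1).trans_lt hΩ.measure_lt_top).ne
  -- The squared difference is the indicator of all points that enter or leave `Ω`; only those
  -- leaving are kept.
  have hle : volume.real {x | x ∈ Ω ∧ x + u ∉ Ω} ≤
      ∫ x, (Ω.indicator (fun _ => (1 : ℝ)) (x + u) - Ω.indicator (fun _ => (1 : ℝ)) x) ^ 2 := by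
    rw [← integral_indicator_one hmeas]
    refine integral_mono_of_nonneg (Filter.Eventually.of_forall fun x =>
      indicator_nonneg (fun _ _ => zero_le_one) x) ?_ (Filter.Eventually.of_forall fun x => ?_)
    · have hi := (hp.1.comp_add_right u).sub hp.1
      have := hi.mul_bdd (g := fun x => Ω.indicator (fun _ => (1 : ℝ)) (x + u) -
        Ω.indicator (fun _ => (1 : ℝ)) x) (c := 1) hi.aestronglyMeasurable
        (Filter.Eventually.of_forall fun x => by
          have h1 := h01 (x + u); have h2 := h01 x
          rw [Real.norm_eq_abs, abs_le]; constructor <;> linarith [h1.1, h1.2, h2.1, h2.2])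
      simpa only [pow_two, Pi.sub_apply] using this
    · by_cases hx : x ∈ Ω <;> by_cases hy : x + u ∈ Ω <;> simp [hx, hy]
  calc volume {x | x ∈ Ω ∧ x + u ∉ Ω} = ENNReal.ofReal (volume.real {x | x ∈ Ω ∧ x + u ∉ Ω}) := by
        rw [ofReal_measureReal hfin]
    _ ≤ ENNReal.ofReal (‖u‖ * perimeter Ω) := ENNReal.ofReal_le_ofReal (hle.trans key)
    _ = _ := by rw [ENNReal.ofReal_mul (norm_nonneg u), ofReal_norm]

end Translation

/-! ### Time-frequency shifts, Moyal's identity, weak form of `H_Ω` -/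

section TimeFrequency

variable {d : ℕ}

theorem conj_cexp_two_pi (s : ℝ) : conj (Complex.exp (2 * π * Complex.I * (s : ℂ))) =
    Complex.exp (-2 * π * Complex.I * (s : ℂ)) := by
  rw [← Complex.exp_conj]
  congr 1
  simp [map_ofNat]

theorem memLp_tfShift (g : L2 d) (z : PhaseSpace d) :
    MemLp (fun t => g (t - z.fst) * Complex.exp (2 * π * Complex.I * (inner ℝ z.snd t : ℝ)))
      2 volume := by
  refine (memLp_shift g z.fst).of_le ?_ (Filter.Eventually.of_forall fun t => ?_)
  · exact (memLp_shift g z.fst).1.mul (by fun_prop : Continuous fun t : EuclideanSpace ℝ (Fin d) =>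
      Complex.exp (2 * π * Complex.I * (inner ℝ z.snd t : ℝ))).aestronglyMeasurable
  · rw [norm_mul, norm_cexp_two_pi, mul_one]

/-- The time-frequency shift `t ↦ g(t - x) exp(2πi ξ·t)` of `g` by `z = (x, ξ)`. -/
def tfShift (g : L2 d) (z : PhaseSpace d) : L2 d := (memLp_tfShift g z).toLp _

theorem coeFn_tfShift (g : L2 d) (z : PhaseSpace d) : tfShift g z =ᵐ[volume]
    fun t => g (t - z.fst) * Complex.exp (2 * π * Complex.I * (inner ℝ z.snd t : ℝ)) :=
  (memLp_tfShift g z).coeFn_toLp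

theorem norm_tfShift (g : L2 d) (z : PhaseSpace d) : ‖tfShift g z‖ = ‖g‖ := by
  rw [tfShift, Lp.norm_toLp, Lp.norm_def]
  congr 1
  rw [← eLpNorm_comp_measurePreserving (Lp.aestronglyMeasurable g)
      (measurePreserving_sub_right volume z.fst)]
  refine eLpNorm_congr_norm_ae (Filter.Eventually.of_forall fun t => ?_)
  rw [norm_mul, norm_cexp_two_pi, mul_one]
  rfl

theorem inner_tfShift (g f : L2 d) (z : PhaseSpace d) :
    inner ℂ (tfShift g z) f = stft g f z := by
  rw [L2.inner_def, stft]
  refine integral_congr_ae ?_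
  filter_upwards [coeFn_tfShift g z] with t ht
  rw [ht, RCLike.inner_apply, map_mul, conj_cexp_two_pi]
  ring

theorem norm_stft_tfShift (g : L2 d) (z w : PhaseSpace d) :
    ‖stft g (tfShift g z) w‖ = ‖stft g g (w - z)‖ := by
  -- The substitution `t ↦ t - z.fst` produces this unimodular phase.
  have h : stft g (tfShift g z) w = stft g g (w - z) *
      Complex.exp (2 * π * Complex.I * (inner ℝ (z.snd - w.snd) z.fst : ℝ)) := by
    rw [stft, stft, ← integral_mul_const,
      ← integral_sub_right_eq_self (μ := volume) (fun t => g t * conj (g (t - (w - z).fst)) *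
        Complex.exp (-2 * π * Complex.I * (inner ℝ (w - z).snd t : ℝ)) *
        Complex.exp (2 * π * Complex.I * (inner ℝ (z.snd - w.snd) z.fst : ℝ))) z.fst]
    refine integral_congr_ae ?_
    filter_upwards [coeFn_tfShift g z] with t ht
    rw [ht]
    have e1 : t - z.fst - (w - z).fst = t - w.fst := by
      rw [WithLp.sub_fst]; abel
    have e2 : Complex.exp (2 * π * Complex.I * (inner ℝ z.snd t : ℝ)) *
        Complex.exp (-2 * π * Complex.I * (inner ℝ w.snd t : ℝ)) =
        Complex.exp (-2 * π * Complex.I * (inner ℝ (w - z).snd (t - z.fst) : ℝ)) *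
        Complex.exp (2 * π * Complex.I * (inner ℝ (z.snd - w.snd) z.fst : ℝ)) := by
      rw [← Complex.exp_add, ← Complex.exp_add]
      congr 1
      rw [WithLp.sub_snd]
      simp only [inner_sub_left, inner_sub_right]
      push_cast
      ring
    rw [e1]
    linear_combination (g (t - z.fst) * conj (g (t - w.fst))) * e2
  rw [h, norm_mul, norm_cexp_two_pi, mul_one]

theorem lintegral_enorm_sq_L2 (f : L2 d) : ∫⁻ t, ‖f t‖ₑ ^ 2 = ‖f‖ₑ ^ 2 := by
  rw [Lp.enorm_def, eLpNorm_eq_lintegral_rpow_enorm_toReal (by simp) (by simp),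
    ← ENNReal.rpow_ofNat, ← ENNReal.rpow_mul]
  simp

theorem lintegral_lintegral_enorm_sq_mul_shift (g f : L2 d) :
    ∫⁻ x : EuclideanSpace ℝ (Fin d), ∫⁻ t, ‖f t * conj (g (t - x))‖ₑ ^ 2 =
      ‖f‖ₑ ^ 2 * ‖g‖ₑ ^ 2 := by
  have hf := (Lp.stronglyMeasurable f).measurable
  have hg := (Lp.stronglyMeasurable g).measurable
  have e : ∀ x t, ‖f t * conj (g (t - x))‖ₑ ^ 2 = ‖f t‖ₑ ^ 2 * ‖g (t - x)‖ₑ ^ 2 := fun x t => by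
    rw [enorm_mul, mul_pow, ← ofReal_norm (conj (g (t - x))), RCLike.norm_conj, ofReal_norm]
  simp only [e]
  rw [lintegral_lintegral_swap (by
    exact (((hf.comp measurable_snd).enorm.pow_const 2).mul
      ((hg.comp (measurable_snd.sub measurable_fst)).enorm.pow_const 2)).aemeasurable)]
  have e2 : ∀ t, ∫⁻ x, ‖f t‖ₑ ^ 2 * ‖g (t - x)‖ₑ ^ 2 = ‖f t‖ₑ ^ 2 * ‖g‖ₑ ^ 2 := fun t => by
    rw [lintegral_const_mul' _ _ (by finiteness), ← lintegral_enorm_sq_L2 g,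
      lintegral_sub_left_eq_self (fun x => ‖g x‖ₑ ^ 2) t]
  simp only [e2]
  rw [lintegral_mul_const' _ _ (by finiteness), lintegral_enorm_sq_L2]

/-- **Moyal's identity**: orthogonality relations for the short-time Fourier transform. -/
theorem lintegral_enorm_stft_sq (g f : L2 d) :
    ∫⁻ z, ‖stft g f z‖ₑ ^ 2 = ‖f‖ₑ ^ 2 * ‖g‖ₑ ^ 2 := by
  have hm : Measurable fun z => ‖stft g f z‖ₑ ^ 2 :=
    (stronglyMeasurable_stft g f).measurable.enorm.pow_const 2
  have hmp := WithLp.volume_preserving_toLp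
    (EuclideanSpace ℝ (Fin d)) (EuclideanSpace ℝ (Fin d))
  rw [← hmp.lintegral_comp hm, Measure.volume_eq_prod,
    lintegral_prod (fun p => ‖stft g f (WithLp.toLp 2 p)‖ₑ ^ 2)
      (hm.comp hmp.measurable).aemeasurable,
    ← lintegral_lintegral_enorm_sq_mul_shift g f]
  have hmj : Measurable (fun p : EuclideanSpace ℝ (Fin d) × EuclideanSpace ℝ (Fin d) =>
      ‖f p.2 * conj (g (p.2 - p.1))‖ₑ ^ 2) := by
    have hf := (Lp.stronglyMeasurable f).measurable
    have hg := (Lp.stronglyMeasurable g).measurable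
    exact (((hf.comp measurable_snd).mul (Complex.continuous_conj.measurable.comp
      (hg.comp (measurable_snd.sub measurable_fst)))).enorm.pow_const 2)
  -- For almost every `x` the product `f · conj g(· - x)` is square integrable as well as
  -- integrable, and `ξ ↦ V_g f(x, ξ)` is its Fourier transform: Plancherel applies in `ξ`.
  have hfin : ∀ᵐ x : EuclideanSpace ℝ (Fin d), ∫⁻ t, ‖f t * conj (g (t - x))‖ₑ ^ 2 < ∞ := by
    refine ae_lt_top hmj.lintegral_prod_right' ?_
    rw [lintegral_lintegral_enorm_sq_mul_shift g f]
    finiteness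
  refine lintegral_congr_ae ?_
  filter_upwards [hfin] with x hx
  have h1 : Integrable (fun t => f t * conj (g (t - x))) :=
    (Lp.memLp f).integrable_mul (memLp_shift g x).star
  have h2 : MemLp (fun t => f t * conj (g (t - x))) 2 := by
    refine ⟨h1.aestronglyMeasurable, ?_⟩
    rw [eLpNorm_lt_top_iff_lintegral_rpow_enorm_lt_top (by simp) (by simp)]
    simpa using hx
  rw [← lintegral_enorm_fourier_sq h1 h2]
  refine lintegral_congr fun ξ => ?_
  rw [Real.fourier_eq', stft]
  congr 2
  refine integral_congr_ae (Filter.Eventually.of_forall fun t => ?_)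
  simp only [smul_eq_mul]
  rw [mul_comm]
  congr 2
  rw [real_inner_comm]
  change -2 * π * Complex.I * ((inner ℝ t ξ : ℝ) : ℂ) = _
  push_cast
  ring

theorem norm_stft_le (g f : L2 d) (z : PhaseSpace d) : ‖stft g f z‖ ≤ ‖g‖ * ‖f‖ := by
  rw [← inner_tfShift, ← norm_tfShift g z]
  exact norm_inner_le_norm _ _

/-- Fubini: Cauchy-Schwarz bounds the `t`-integral of the absolute value uniformly in `z`, and `Ω`
has finite measure. -/
theorem inner_locOp (g : L2 d) {Ω : Set (PhaseSpace d)} (hΩ : IsCompact Ω) (h f : L2 d) :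
    inner ℂ h (locOp g Ω hΩ f) = ∫ z in Ω, conj (stft g h z) * stft g f z := by
  have hfin : IsFiniteMeasure (volume.restrict Ω) := ⟨by simpa using hΩ.measure_lt_top⟩
  have hh := (Lp.stronglyMeasurable h).measurable
  have hm : Measurable (fun p : EuclideanSpace ℝ (Fin d) × PhaseSpace d =>
      conj (h p.1) * (stft g f p.2 * g (p.1 - p.2.fst) *
        Complex.exp (2 * π * Complex.I * (inner ℝ p.2.snd p.1 : ℝ)))) :=
    (Complex.continuous_conj.measurable.comp (hh.comp measurable_fst)).mul
      (measurable_locFun_integrand g f)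
  have hint : ∀ z, Integrable (fun t : EuclideanSpace ℝ (Fin d) =>
      conj (h t) * (stft g f z * g (t - z.fst) *
        Complex.exp (2 * π * Complex.I * (inner ℝ z.snd t : ℝ)))) := fun z => by
    have := ((Lp.memLp h).star.integrable_mul (memLp_tfShift g z)).const_mul (stft g f z)
    refine this.congr (Filter.Eventually.of_forall fun t => ?_)
    simp only [Pi.mul_apply, Pi.star_apply, RCLike.star_def]
    ring
  have hinner : ∀ z, ∫ t : EuclideanSpace ℝ (Fin d),
      conj (h t) * (stft g f z * g (t - z.fst) *
        Complex.exp (2 * π * Complex.I * (inner ℝ z.snd t : ℝ))) =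
      conj (stft g h z) * stft g f z := fun z => by
    rw [← inner_tfShift g h, inner_conj_symm, L2.inner_def, ← integral_mul_const]
    refine integral_congr_ae ?_
    filter_upwards [coeFn_tfShift g z] with t ht
    rw [ht, RCLike.inner_apply]
    ring
  have hinner_norm : ∀ z, ∫ t : EuclideanSpace ℝ (Fin d),
      ‖conj (h t) * (stft g f z * g (t - z.fst) *
        Complex.exp (2 * π * Complex.I * (inner ℝ z.snd t : ℝ)))‖ ≤ ‖g‖ * ‖f‖ * (‖h‖ * ‖g‖) :=
    fun z => by
    have e : ∀ t, ‖conj (h t) * (stft g f z * g (t - z.fst) *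
        Complex.exp (2 * π * Complex.I * (inner ℝ z.snd t : ℝ)))‖ =
        ‖stft g f z‖ * (‖h t‖ * ‖g (t - z.fst)‖) := fun t => by
      rw [norm_mul, norm_mul, norm_mul, norm_cexp_two_pi, RCLike.norm_conj]; ring
    simp only [e]
    rw [integral_const_mul]
    refine mul_le_mul (norm_stft_le g f z) ?_ (by positivity) (by positivity)
    have hs := (memLp_shift g z.fst)
    have hN : ‖hs.norm.toLp _‖ = ‖g‖ := by
      rw [Lp.norm_toLp, Lp.norm_def, eLpNorm_norm,
        ← eLpNorm_comp_measurePreserving (Lp.aestronglyMeasurable g)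
          (measurePreserving_sub_right volume z.fst)]
      rfl
    have hN' : ‖(Lp.memLp h).norm.toLp _‖ = ‖h‖ := by
      rw [Lp.norm_toLp, Lp.norm_def, eLpNorm_norm]
    have := real_inner_le_norm ((Lp.memLp h).norm.toLp _) (hs.norm.toLp _)
    rw [hN, hN', L2.inner_def] at this
    refine le_trans (le_of_eq (integral_congr_ae ?_)) this
    filter_upwards [(Lp.memLp h).norm.coeFn_toLp, hs.norm.coeFn_toLp] with t h1 h2
    rw [h1, h2, real_inner_eq_re_inner, RCLike.inner_apply]
    simp [mul_comm]
  have hprod : Integrable (fun p : EuclideanSpace ℝ (Fin d) × PhaseSpace d =>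
      conj (h p.1) * (stft g f p.2 * g (p.1 - p.2.fst) *
        Complex.exp (2 * π * Complex.I * (inner ℝ p.2.snd p.1 : ℝ))))
      (volume.prod (volume.restrict Ω)) := by
    rw [integrable_prod_iff' hm.aestronglyMeasurable]
    refine ⟨Filter.Eventually.of_forall hint, ?_⟩
    refine (integrable_const (‖g‖ * ‖f‖ * (‖h‖ * ‖g‖))).mono' ?_
      (Filter.Eventually.of_forall fun z => ?_)
    · exact (StronglyMeasurable.integral_prod_left'
        (μ := (volume : Measure (EuclideanSpace ℝ (Fin d))))
        hm.stronglyMeasurable.norm).aestronglyMeasurable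
    · rw [Real.norm_of_nonneg (by positivity)]
      exact hinner_norm z
  calc inner ℂ h (locOp g Ω hΩ f)
      = ∫ t, conj (h t) * locFun g Ω f t := by
        rw [L2.inner_def]
        refine integral_congr_ae ?_
        filter_upwards [(memLp_locFun g hΩ f).coeFn_toLp] with t ht
        change inner ℂ (h t) ((memLp_locFun g hΩ f).toLp (locFun g Ω f) t) = _
        rw [ht, RCLike.inner_apply, mul_comm]
    _ = ∫ t, ∫ z in Ω, conj (h t) * (stft g f z * g (t - z.fst) *
        Complex.exp (2 * π * Complex.I * (inner ℝ z.snd t : ℝ))) := by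
        simp only [locFun, integral_const_mul]
    _ = ∫ z in Ω, ∫ t, conj (h t) * (stft g f z * g (t - z.fst) *
        Complex.exp (2 * π * Complex.I * (inner ℝ z.snd t : ℝ))) :=
        integral_integral_swap hprod
    _ = _ := by simp only [hinner]

end TimeFrequency

/-! ### Compact self-adjoint operators and eigenvalue counting -/

section Hilbert

variable {E : Type*} [NormedAddCommGroup E] [InnerProductSpace ℂ E]

/-- Orthonormal vectors lie at mutual distance `√2`, so balls of radius `1/2` around them are
disjoint. Countability is what allows dominated convergence for series over a basis. -/
theorem Orthonormal.countable {ι : Type*} [TopologicalSpace.SeparableSpace E] {v : ι → E}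
    (hv : Orthonormal ℂ v) : Countable ι := by
  rw [← Set.countable_univ_iff]
  refine Set.PairwiseDisjoint.countable_of_isOpen (s := fun i => Metric.ball (v i) (1 / 2))
    ?_ (fun i _ => Metric.isOpen_ball) (fun i _ => ⟨v i, Metric.mem_ball_self (by norm_num)⟩)
  intro i _ j _ hij
  refine Metric.ball_disjoint_ball ?_
  have h : ‖v i - v j‖ ^ 2 = 2 := by
    rw [@norm_sub_sq ℂ, hv.1 i, hv.1 j, hv.2 hij]
    norm_num
  rw [dist_eq_norm]
  nlinarith [norm_nonneg (v i - v j)]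

theorem HilbertBasis.hasSum_norm_inner_sq {ι : Type*} (b : HilbertBasis ι ℂ E) (x : E) :
    HasSum (fun i => ‖inner ℂ x (b i)‖ ^ 2) (‖x‖ ^ 2) := by
  have h := Complex.hasSum_re (b.hasSum_inner_mul_inner x x)
  rw [inner_self_eq_norm_sq_to_K] at h
  convert h using 1
  · ext i
    rw [← inner_conj_symm (b i) x, Complex.mul_conj, Complex.normSq_eq_norm_sq]
    rfl
  · norm_cast

/-- A Hilbert-Schmidt operator is compact. -/
theorem HilbertBasis.isCompactOperator_of_summable {ι : Type*} [CompleteSpace E]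
    (b : HilbertBasis ι ℂ E) (T : E →L[ℂ] E) (h : Summable fun i => ‖T (b i)‖ ^ 2) :
    IsCompactOperator T := by
  -- Finite-rank truncations of `T`. By Cauchy-Schwarz their error in operator norm is at most the
  -- root of the tail of `∑ ‖T (b i)‖²`.
  let F : Finset ι → E →L[ℂ] E := fun s => ∑ i ∈ s, InnerProductSpace.rankOne ℂ (T (b i)) (b i)
  have hFapp : ∀ s f, F s f = ∑ i ∈ s, inner ℂ (b i) f • T (b i) := fun s f => by
    simp [F]
  have hbound : ∀ s, ‖T - F s‖ ≤ √(∑' i, ‖T (b i)‖ ^ 2 - ∑ i ∈ s, ‖T (b i)‖ ^ 2) := fun s => by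
    refine ContinuousLinearMap.opNorm_le_bound _ (Real.sqrt_nonneg _) fun f => ?_
    have hT : HasSum (fun i => inner ℂ (b i) f • T (b i)) (T f) := by
      have := (b.hasSum_repr f).mapL T
      simpa only [map_smul, b.repr_apply_apply] using this
    have hlim : Filter.Tendsto (fun t : Finset ι => ‖F t f - F s f‖) Filter.atTop
        (nhds ‖(T - F s) f‖) := by
      refine Filter.Tendsto.norm ?_
      simp only [hFapp, sub_apply]
      exact Filter.Tendsto.sub_const hT _
    classical
    refine le_of_tendsto hlim ?_
    filter_upwards [Filter.eventually_ge_atTop s] with t hst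
    have e : F t f - F s f = ∑ i ∈ t \ s, inner ℂ (b i) f • T (b i) := by
      rw [hFapp, hFapp, ← Finset.sum_sdiff hst, add_sub_cancel_right]
    calc ‖F t f - F s f‖ ≤ ∑ i ∈ t \ s, ‖inner ℂ f (b i)‖ * ‖T (b i)‖ := by
          rw [e]
          refine (norm_sum_le _ _).trans (le_of_eq (Finset.sum_congr rfl fun i _ => ?_))
          rw [norm_smul, norm_inner_symm]
      _ ≤ √(∑ i ∈ t \ s, ‖inner ℂ f (b i)‖ ^ 2) * √(∑ i ∈ t \ s, ‖T (b i)‖ ^ 2) :=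
          Real.sum_mul_le_sqrt_mul_sqrt _ _ _
      _ ≤ ‖f‖ * √(∑' i, ‖T (b i)‖ ^ 2 - ∑ i ∈ s, ‖T (b i)‖ ^ 2) := by
          gcongr
          · rw [Real.sqrt_le_left (norm_nonneg f)]
            exact sum_le_hasSum _ (fun i _ => by positivity) (b.hasSum_norm_inner_sq f)
          · have h1 := Finset.sum_sdiff (f := fun i => ‖T (b i)‖ ^ 2) hst
            have h2 := h.sum_le_tsum t (fun i _ => by positivity)
            linarith
      _ = _ := mul_comm _ _
  have hlim : Filter.Tendsto F Filter.atTop (nhds T) := by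
    rw [tendsto_iff_norm_sub_tendsto_zero]
    refine squeeze_zero (fun _ => norm_nonneg _)
      (g := fun s => √(∑' i, ‖T (b i)‖ ^ 2 - ∑ i ∈ s, ‖T (b i)‖ ^ 2))
      (fun s => by rw [norm_sub_rev]; exact hbound s) ?_
    have : Filter.Tendsto (fun s : Finset ι => ∑' i, ‖T (b i)‖ ^ 2 - ∑ i ∈ s, ‖T (b i)‖ ^ 2)
        Filter.atTop (nhds (∑' i, ‖T (b i)‖ ^ 2 - ∑' i, ‖T (b i)‖ ^ 2)) :=
      Filter.Tendsto.const_sub _ h.hasSum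
    rw [sub_self] at this
    simpa using this.sqrt
  refine isCompactOperator_of_tendsto hlim (Filter.Eventually.of_forall fun s => ?_)
  refine Submodule.sum_mem (compactOperator (RingHom.id ℂ) E E) fun i _ => ?_
  change IsCompactOperator fun f => inner ℂ (b i) f • T (b i)
  exact (isCompactOperator_of_locallyCompactSpace_dom (innerSL ℂ (b i))).clm_comp
    (ContinuousLinearMap.toSpanSingleton ℂ (T (b i)))

/-- **Spectral theorem**: a compact self-adjoint operator has a Hilbert basis of eigenvectors. -/
theorem exists_hilbertBasis_eigenvectors.{u} {E : Type u} [NormedAddCommGroup E]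
    [InnerProductSpace ℂ E] [CompleteSpace E] {T : E →L[ℂ] E}
    (hT : IsCompactOperator T) (hs : (T : E →ₗ[ℂ] E).IsSymmetric) :
    ∃ (ι : Type u) (b : HilbertBasis ι ℂ E) (l : ι → ℝ), ∀ i, T (b i) = (l i : ℂ) • b i := by
  have hcl : ∀ μ : ℂ, CompleteSpace (Module.End.eigenspace (T : E →ₗ[ℂ] E) μ) := fun μ => by
    have : IsClosed (Module.End.eigenspace (T : E →ₗ[ℂ] E) μ : Set E) := by
      have e : (Module.End.eigenspace (T : E →ₗ[ℂ] E) μ : Set E) = {x | T x = μ • x} := by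
        ext x; simp
      rw [e]
      exact isClosed_eq T.continuous (continuous_const_smul μ)
    exact this.completeSpace_coe
  choose w c _ using fun μ : ℂ =>
    exists_hilbertBasis ℂ (Module.End.eigenspace (T : E →ₗ[ℂ] E) μ)
  -- Bases of all eigenspaces are glued, over every complex `μ`: non-eigenvalues contribute nothing,
  -- and `μ = 0` supplies the kernel.
  let v : (Σ μ : ℂ, w μ) → E := fun a => (c a.1 a.2 : E)
  have hv : Orthonormal ℂ v :=
    hs.orthogonalFamily_eigenspaces.orthonormal_sigma_orthonormal (fun μ => (c μ).orthonormal)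
  have hbot : (Submodule.span ℂ (Set.range v))ᗮ = ⊥ := by
    rw [eq_bot_iff, ← ContinuousLinearMap.orthogonalComplement_iSup_eigenspaces_eq_bot hT hs]
    intro x hx
    rw [Submodule.mem_orthogonal'] at hx
    rw [← Submodule.iInf_orthogonal, Submodule.mem_iInf]
    intro μ
    rw [Submodule.mem_orthogonal']
    intro y hy
    have h := ((c μ).hasSum_repr ⟨y, hy⟩).mapL
      ((innerSL ℂ x).comp (Module.End.eigenspace (T : E →ₗ[ℂ] E) μ).subtypeL)
    have h0 : ∀ i, ((innerSL ℂ x).comp (Module.End.eigenspace (T : E →ₗ[ℂ] E) μ).subtypeL)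
        ((c μ).repr ⟨y, hy⟩ i • c μ i) = 0 := fun i => by
      have h1 : inner ℂ x (c μ i : E) = 0 := hx (v ⟨μ, i⟩) (Submodule.subset_span ⟨_, rfl⟩)
      rw [map_smul]
      change _ • inner ℂ x (c μ i : E) = 0
      rw [h1, smul_zero]
    simp only [h0] at h
    exact h.unique hasSum_zero
  refine ⟨_, HilbertBasis.mkOfOrthogonalEqBot hv hbot, fun a => a.1.re, fun a => ?_⟩
  rw [HilbertBasis.coe_mkOfOrthogonalEqBot]
  have hmem : v a ∈ Module.End.eigenspace (T : E →ₗ[ℂ] E) a.1 := (c a.1 a.2).2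
  have hreal : conj a.1 = a.1 := hs.conj_eigenvalue_eq_self
    (Module.End.hasEigenvalue_of_hasEigenvector ⟨hmem, hv.ne_zero a⟩)
  rw [Complex.conj_eq_iff_re.1 hreal]
  exact Module.End.mem_eigenspace_iff.1 hmem

/-- By symmetry, an eigenvector for `μ` has zero coefficient on every `b i` with `l i ≠ μ`. For `μ >
a` it therefore lies in the span of the `b i` with `i ∈ S`. -/
theorem HilbertBasis.eigenvalueCount_eq {ι : Type*} (b : HilbertBasis ι ℂ E) {T : E →ₗ[ℂ] E}
    {l : ι → ℝ} (hs : T.IsSymmetric) (hb : ∀ i, T (b i) = (l i : ℂ) • b i) (a : ℝ)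
    (S : Finset ι) (hS : ∀ i, i ∈ S ↔ a < l i) : eigenvalueCount T a = (S.card : ℕ∞) := by
  have hspan : (⨆ μ ∈ Set.Ioi a, Module.End.eigenspace T (μ : ℂ) : Submodule ℂ E) =
      Submodule.span ℂ (Set.range fun i : S => b i) := by
    refine le_antisymm (iSup₂_le fun μ hμ x hx => ?_) (Submodule.span_le.2 ?_)
    · have hx' := Module.End.mem_eigenspace_iff.1 hx
      have h0 : ∀ i, i ∉ S → b.repr x i • b i = 0 := fun i hi => by
        have hne : (μ : ℂ) - l i ≠ 0 := by
          rw [hS, not_lt] at hi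
          rw [sub_ne_zero, Ne, Complex.ofReal_inj]
          exact (lt_of_le_of_lt hi hμ).ne'
        have h1 : inner ℂ (T (b i)) x = inner ℂ (b i) (T x) := hs _ _
        rw [hb, hx', inner_smul_left, inner_smul_right, Complex.conj_ofReal] at h1
        have h2 : ((μ : ℂ) - l i) * inner ℂ (b i) x = 0 := by rw [sub_mul, h1, sub_self]
        rw [b.repr_apply_apply, (mul_eq_zero.1 h2).resolve_left hne, zero_smul]
      rw [(b.hasSum_repr x).unique (hasSum_sum_of_ne_finset_zero fun i hi => h0 i hi)]
      exact Submodule.sum_mem _ fun i hi =>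
        Submodule.smul_mem _ _ (Submodule.subset_span ⟨⟨i, hi⟩, rfl⟩)
    · rintro _ ⟨i, rfl⟩
      exact Submodule.mem_iSup_of_mem (l i) (Submodule.mem_iSup_of_mem ((hS i).1 i.2)
        (Module.End.mem_eigenspace_iff.2 (hb i)))
  have hli : LinearIndependent ℂ fun i : S => b i :=
    (b.orthonormal.comp _ Subtype.val_injective).linearIndependent
  have : FiniteDimensional ℂ (Submodule.span ℂ (Set.range fun i : S => b i)) :=
    FiniteDimensional.span_of_finite ℂ (Set.finite_range _)
  rw [eigenvalueCount, hspan, ← Module.finrank_eq_rank, finrank_span_eq_card hli]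
  simp

end Hilbert

/-! ### Spectrum and traces of the localization operator -/

section Localization

variable {d : ℕ}

theorem integrable_norm_stft_sq (g f : L2 d) : Integrable fun z => ‖stft g f z‖ ^ 2 := by
  refine ⟨((stronglyMeasurable_stft g f).norm.pow 2).aestronglyMeasurable, ?_⟩
  rw [hasFiniteIntegral_iff_enorm]
  simp only [enorm_pow, enorm_norm]
  rw [lintegral_enorm_stft_sq]
  finiteness

theorem integral_norm_stft_sq (g f : L2 d) : ∫ z, ‖stft g f z‖ ^ 2 = ‖f‖ ^ 2 * ‖g‖ ^ 2 := by
  rw [integral_eq_lintegral_of_nonneg_ae (Filter.Eventually.of_forall fun z => by positivity)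
    (integrable_norm_stft_sq g f).aestronglyMeasurable]
  simp only [ENNReal.ofReal_pow (norm_nonneg _), ofReal_norm]
  rw [lintegral_enorm_stft_sq]
  simp

theorem setIntegral_norm_stft_sq_le {g : L2 d} (hg : ‖g‖ = 1) (Ω : Set (PhaseSpace d))
    (f : L2 d) : ∫ z in Ω, ‖stft g f z‖ ^ 2 ≤ ‖f‖ ^ 2 := by
  refine (setIntegral_le_integral (integrable_norm_stft_sq g f)
    (Filter.Eventually.of_forall fun z => by positivity)).trans ?_
  rw [integral_norm_stft_sq, hg]
  simp

theorem inner_locOp_self (g : L2 d) {Ω : Set (PhaseSpace d)} (hΩ : IsCompact Ω) (f : L2 d) :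
    inner ℂ f (locOp g Ω hΩ f) = ((∫ z in Ω, ‖stft g f z‖ ^ 2 : ℝ) : ℂ) := by
  rw [inner_locOp, ← integral_complex_ofReal]
  congr 1
  ext z
  rw [RCLike.conj_mul]
  norm_cast

theorem locOp_isSymmetric (g : L2 d) {Ω : Set (PhaseSpace d)} (hΩ : IsCompact Ω) :
    (locOp g Ω hΩ).IsSymmetric := fun f h => by
  rw [← inner_conj_symm, inner_locOp, inner_locOp, ← integral_conj]
  congr 1
  ext z
  rw [map_mul, Complex.conj_conj, mul_comm]

/-- This is `H_Ω² ≤ H_Ω`. Put `h = H_Ω f` in the weak form and use `ab ≤ (a² + b²)/2`; the term `½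
∫_Ω |V_g h|² ≤ ½ ‖h‖²` is absorbed. -/
theorem norm_locOp_sq_le {g : L2 d} (hg : ‖g‖ = 1) {Ω : Set (PhaseSpace d)} (hΩ : IsCompact Ω)
    (f : L2 d) : ‖locOp g Ω hΩ f‖ ^ 2 ≤ ∫ z in Ω, ‖stft g f z‖ ^ 2 := by
  set h := locOp g Ω hΩ f
  have h1 : ‖h‖ ^ 2 = ‖inner ℂ h h‖ := by
    rw [inner_self_eq_norm_sq_to_K, norm_pow]; simp
  have h2 : ‖inner ℂ h (locOp g Ω hΩ f)‖ ≤
      ∫ z in Ω, (1 / 2 * ‖stft g h z‖ ^ 2 + 1 / 2 * ‖stft g f z‖ ^ 2) := by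
    rw [inner_locOp]
    refine norm_integral_le_of_norm_le
      (((integrable_norm_stft_sq g h).const_mul _).add
        ((integrable_norm_stft_sq g f).const_mul _)).integrableOn
      (Filter.Eventually.of_forall fun z => ?_)
    rw [norm_mul, RCLike.norm_conj]
    nlinarith [sq_nonneg (‖stft g h z‖ - ‖stft g f z‖)]
  rw [integral_add ((integrable_norm_stft_sq g h).const_mul _).integrableOn
    ((integrable_norm_stft_sq g f).const_mul _).integrableOn, integral_const_mul,
    integral_const_mul] at h2
  have h3 := setIntegral_norm_stft_sq_le hg Ω h
  change ‖inner ℂ h h‖ ≤ _ at h2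
  linarith

/-- The localization operator as a bounded operator, for a normalized window. -/
def locCLM {g : L2 d} (hg : ‖g‖ = 1) {Ω : Set (PhaseSpace d)} (hΩ : IsCompact Ω) :
    L2 d →L[ℂ] L2 d :=
  (locOp g Ω hΩ).mkContinuous 1 fun f => by
    rw [one_mul]
    exact (pow_le_pow_iff_left₀ (norm_nonneg _) (norm_nonneg _) two_ne_zero).1
      ((norm_locOp_sq_le hg hΩ f).trans (setIntegral_norm_stft_sq_le hg Ω f))

/-- Sum and integral are exchanged with dominating sum `∑ |V_g (b i)(z)|² = 1`, Parseval for
`π(z)g`. Weights `1` give the trace, weights `1 - l i` the sum of `l i - (l i)²`. -/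
theorem hasSum_setIntegral_norm_stft_sq {g : L2 d} (hg : ‖g‖ = 1) {Ω : Set (PhaseSpace d)}
    (hΩ : IsCompact Ω) {ι : Type*} (b : HilbertBasis ι ℂ (L2 d)) {c : ι → ℝ}
    (hc : ∀ i, |c i| ≤ 1) {G : PhaseSpace d → ℝ}
    (hG : ∀ z, HasSum (fun i => c i * ‖stft g (b i) z‖ ^ 2) (G z)) :
    HasSum (fun i => c i * ∫ z in Ω, ‖stft g (b i) z‖ ^ 2) (∫ z in Ω, G z) := by
  have : Fact ((2 : ℝ≥0∞) ≠ ∞) := ⟨by simp⟩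
  have : Countable ι := b.orthonormal.countable
  have hfin : IsFiniteMeasure (volume.restrict Ω) := ⟨by simpa using hΩ.measure_lt_top⟩
  have hsum : ∀ z, HasSum (fun i => ‖stft g (b i) z‖ ^ 2) 1 := fun z => by
    simpa only [inner_tfShift, norm_tfShift, hg, one_pow] using
      b.hasSum_norm_inner_sq (tfShift g z)
  simp only [← integral_const_mul]
  refine hasSum_integral_of_dominated_convergence (fun i z => ‖stft g (b i) z‖ ^ 2)
    (fun i => ((integrable_norm_stft_sq g (b i)).const_mul _).aestronglyMeasurable.restrict)
    (fun i => Filter.Eventually.of_forall fun z => ?_)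
    (Filter.Eventually.of_forall fun z => (hsum z).summable) ?_
    (Filter.Eventually.of_forall hG)
  · rw [norm_mul, Real.norm_eq_abs, norm_pow, norm_norm]
    exact mul_le_of_le_one_left (by positivity) (hc i)
  · simp only [(hsum _).tsum_eq]
    exact integrable_const 1

/-- The trace of the localization operator, computed in an arbitrary Hilbert basis. -/
theorem hasSum_trace_locOp {g : L2 d} (hg : ‖g‖ = 1) {Ω : Set (PhaseSpace d)}
    (hΩ : IsCompact Ω) {ι : Type*} (b : HilbertBasis ι ℂ (L2 d)) :
    HasSum (fun i => ∫ z in Ω, ‖stft g (b i) z‖ ^ 2) (volume.real Ω) := by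
  have h := hasSum_setIntegral_norm_stft_sq hg hΩ b (c := fun _ => 1) (G := fun _ => 1)
    (fun _ => by simp) (fun z => by
      simpa only [inner_tfShift, norm_tfShift, hg, one_pow, one_mul] using
        b.hasSum_norm_inner_sq (tfShift g z))
  simpa using h

/-- Hilbert-Schmidt: `‖H_Ω (b i)‖²` is at most the diagonal entry `∫_Ω |V_g (b i)|²`, and these sum
to `|Ω|`. -/
theorem locCLM_isCompactOperator {g : L2 d} (hg : ‖g‖ = 1) {Ω : Set (PhaseSpace d)}
    (hΩ : IsCompact Ω) : IsCompactOperator (locCLM hg hΩ) := by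
  obtain ⟨w, b, -⟩ := exists_hilbertBasis ℂ (L2 d)
  exact b.isCompactOperator_of_summable _ (Summable.of_nonneg_of_le (fun i => by positivity)
    (fun i => norm_locOp_sq_le hg hΩ (b i)) (hasSum_trace_locOp hg hΩ b).summable)

/-- The quadratic form of the localization operator at a time-frequency shift of the window. -/
theorem hasSum_eigenvalue_mul_norm_stft_sq {g : L2 d} {Ω : Set (PhaseSpace d)}
    (hΩ : IsCompact Ω) {ι : Type*} (b : HilbertBasis ι ℂ (L2 d)) {l : ι → ℝ}
    (hb : ∀ i, locOp g Ω hΩ (b i) = (l i : ℂ) • b i) (z : PhaseSpace d) :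
    HasSum (fun i => l i * ‖stft g (b i) z‖ ^ 2) (∫ w in Ω, ‖stft g g (w - z)‖ ^ 2) := by
  have h := Complex.hasSum_re
    (b.hasSum_inner_mul_inner (tfShift g z) (locOp g Ω hΩ (tfShift g z)))
  rw [inner_locOp_self] at h
  simp only [Complex.ofReal_re, norm_stft_tfShift] at h
  convert h using 1
  ext i
  have h1 : inner ℂ (b i) (locOp g Ω hΩ (tfShift g z)) = l i * inner ℂ (b i) (tfShift g z) := by
    rw [← locOp_isSymmetric g hΩ (b i), hb, inner_smul_left, Complex.conj_ofReal]
  rw [h1, ← inner_conj_symm (b i) (tfShift g z), inner_tfShift, mul_left_comm, Complex.mul_conj,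
    Complex.normSq_eq_norm_sq]
  norm_cast

/-- The total mass of `|V_g g|²` is 1 by Moyal, so what remains is the mass over `Ωᶜ`, recentred by
`w = z + u`. -/
theorem one_sub_setIntegral_norm_stft_sq {g : L2 d} (hg : ‖g‖ = 1) {Ω : Set (PhaseSpace d)}
    (hΩ : IsCompact Ω) (z : PhaseSpace d) :
    ENNReal.ofReal (1 - ∫ w in Ω, ‖stft g g (w - z)‖ ^ 2) =
      ∫⁻ u, Ωᶜ.indicator 1 (z + u) * ‖stft g g u‖ₑ ^ 2 := by
  have hi := (integrable_norm_stft_sq g g).comp_sub_right z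
  have h1 := integral_add_compl hΩ.measurableSet hi
  rw [integral_sub_right_eq_self (μ := volume) (fun w => ‖stft g g w‖ ^ 2),
    integral_norm_stft_sq, hg] at h1
  have h2 : 1 - ∫ w in Ω, ‖stft g g (w - z)‖ ^ 2 = ∫ w in Ωᶜ, ‖stft g g (w - z)‖ ^ 2 := by
    linarith
  rw [h2, ofReal_integral_eq_lintegral_ofReal hi.integrableOn
    (Filter.Eventually.of_forall fun w => by positivity),
    ← lintegral_indicator hΩ.measurableSet.compl,
    ← lintegral_add_left_eq_self _ z]
  refine lintegral_congr fun u => ?_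
  by_cases hu : z + u ∈ Ω <;> simp [hu, ENNReal.ofReal_pow]

/-- After Tonelli, the `z`-integral for fixed `u` is the measure of the points leaving `Ω` under
translation by `u`; the factor `‖u‖` in its bound builds the `M*` integral. -/
theorem setIntegral_one_sub_le {g : L2 d} (hg : ‖g‖ = 1) (hgM : MemMStar g)
    {Ω : Set (PhaseSpace d)} (hΩ : IsCompact Ω) (hp : HasFinitePerimeter Ω) :
    ∫ z in Ω, (1 - ∫ w in Ω, ‖stft g g (w - z)‖ ^ 2) ≤ mStarNorm g ^ 2 * perimeter Ω := by
  have hstft := (stronglyMeasurable_stft g g).measurable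
  have hP : 0 ≤ perimeter Ω := ENNReal.toReal_nonneg
  have hM : mStarNorm g ^ 2 = (mStarIntegral g).toReal := Real.sq_sqrt ENNReal.toReal_nonneg
  have hmind : Measurable (Ωᶜ.indicator (1 : PhaseSpace d → ℝ≥0∞)) :=
    measurable_one.indicator hΩ.measurableSet.compl
  have hmj : Measurable fun p : PhaseSpace d × PhaseSpace d =>
      Ωᶜ.indicator 1 (p.1 + p.2) * ‖stft g g p.2‖ₑ ^ 2 :=
    (hmind.comp (measurable_fst.add measurable_snd)).mul
      ((hstft.comp measurable_snd).enorm.pow_const 2)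
  have key : ∫⁻ z in Ω, ∫⁻ u, Ωᶜ.indicator 1 (z + u) * ‖stft g g u‖ₑ ^ 2 ≤
      mStarIntegral g * ENNReal.ofReal (perimeter Ω) := by
    rw [lintegral_lintegral_swap hmj.aemeasurable, mStarIntegral,
      ← lintegral_mul_const' _ _ ENNReal.ofReal_ne_top]
    refine lintegral_mono fun u => ?_
    have hS : MeasurableSet {z : PhaseSpace d | z + u ∉ Ω} :=
      hΩ.measurableSet.compl.preimage (measurable_add_const u)
    have e : ∫⁻ z in Ω, Ωᶜ.indicator 1 (z + u) = volume {z | z ∈ Ω ∧ z + u ∉ Ω} := by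
      have e1 : ∀ z, Ωᶜ.indicator (1 : PhaseSpace d → ℝ≥0∞) (z + u) =
          {z : PhaseSpace d | z + u ∉ Ω}.indicator 1 z := fun z => by
        by_cases hz : z + u ∈ Ω <;> simp [hz]
      simp only [e1]
      rw [lintegral_indicator_one hS, Measure.restrict_apply hS, inter_comm]
      rfl
    rw [lintegral_mul_const' _ _ (by finiteness), e]
    calc volume {z | z ∈ Ω ∧ z + u ∉ Ω} * ‖stft g g u‖ₑ ^ 2
        ≤ ‖u‖ₑ * ENNReal.ofReal (perimeter Ω) * ‖stft g g u‖ₑ ^ 2 := by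
          gcongr
          exact volume_diff_translate_le hΩ hp u
      _ = _ := by ring
  have h0 : ∀ z, 0 ≤ 1 - ∫ w in Ω, ‖stft g g (w - z)‖ ^ 2 := fun z => by
    have h := setIntegral_norm_stft_sq_le hg Ω (tfShift g z)
    simp only [norm_stft_tfShift, norm_tfShift, hg] at h
    linarith
  have hmeas : StronglyMeasurable fun z => 1 - ∫ w in Ω, ‖stft g g (w - z)‖ ^ 2 := by
    refine stronglyMeasurable_const.sub (StronglyMeasurable.integral_prod_right
      (f := fun (z w : PhaseSpace d) => ‖stft g g (w - z)‖ ^ 2) ?_)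
    exact ((hstft.comp (measurable_snd.sub measurable_fst)).norm.pow_const 2).stronglyMeasurable
  rw [integral_eq_lintegral_of_nonneg_ae (Filter.Eventually.of_forall h0)
    hmeas.aestronglyMeasurable]
  simp only [one_sub_setIntegral_norm_stft_sq hg hΩ]
  rw [hM, ← ENNReal.toReal_ofReal hP, ← ENNReal.toReal_mul]
  exact ENNReal.toReal_mono (ENNReal.mul_ne_top hgM.ne ENNReal.ofReal_ne_top) key

end Localization

/-! ### Thresholding and conclusion -/

/-- A `{0, 1}`-valued threshold of `l ∈ [0, 1]` differs from `l` by at most a multiple of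
`l (1 - l)`. -/
theorem abs_threshold_sub_le {δ l : ℝ} (hδ : δ ∈ Ioo (0 : ℝ) 1) (h0 : 0 ≤ l) (h1 : l ≤ 1) :
    |(if 1 - δ < l then 1 else 0) - l| ≤ max (1 / δ) (1 / (1 - δ)) * (l - l ^ 2) := by
  have hl : 0 ≤ l - l ^ 2 := by nlinarith
  have hδ' : 0 < 1 - δ := by linarith [hδ.2]
  split_ifs with h
  -- Here `l > 1 - δ`, so `(1 - l)(1 - δ) ≤ (1 - l) l`. In the other case `1 - l ≥ δ`, so `l δ ≤ l
  -- (1 - l)`.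
  · rw [abs_of_nonneg (by linarith)]
    refine le_trans ?_ (mul_le_mul_of_nonneg_right (le_max_right _ _) hl)
    rw [div_mul_eq_mul_div, one_mul, le_div_iff₀ hδ']
    nlinarith
  · rw [zero_sub, abs_neg, abs_of_nonneg h0]
    refine le_trans ?_ (mul_le_mul_of_nonneg_right (le_max_left _ _) hl)
    rw [div_mul_eq_mul_div, one_mul, le_div_iff₀ hδ.1]
    nlinarith

theorem mainTheorem5 (d : ℕ) (g : L2 d) (hg_norm : ‖g‖ = 1) (hg : MemMStar g)
    (Ω : Set (PhaseSpace d)) (hΩ : IsCompact Ω) (hΩ_per : HasFinitePerimeter Ω)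
    (δ : ℝ) (hδ : δ ∈ Set.Ioo (0 : ℝ) 1) :
    ∃ N : ℕ, eigenvalueCount (locOp g Ω hΩ) (1 - δ) = (N : ℕ∞) ∧
      |(N : ℝ) - volume.real Ω| ≤
        max (1 / δ) (1 / (1 - δ)) * mStarNorm g ^ 2 * perimeter Ω := by
  have hsymm := locOp_isSymmetric g hΩ
  obtain ⟨ι, b, l, hb⟩ :=
    exists_hilbertBasis_eigenvectors (locCLM_isCompactOperator hg_norm hΩ) hsymm
  replace hb : ∀ i, locOp g Ω hΩ (b i) = (l i : ℂ) • b i := hb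
  -- The eigenvalue is the quadratic form of `H_Ω` at the unit vector `b i`.
  have hl : ∀ i, ∫ z in Ω, ‖stft g (b i) z‖ ^ 2 = l i := fun i => by
    have h := inner_locOp_self g hΩ (b i)
    rw [hb, inner_smul_right, inner_self_eq_norm_sq_to_K, b.orthonormal.1 i] at h
    simp only [RCLike.ofReal_one, one_pow, mul_one] at h
    exact_mod_cast h.symm
  have hl0 : ∀ i, 0 ≤ l i := fun i => by
    rw [← hl i]; exact integral_nonneg fun z => by positivity
  have hl1 : ∀ i, l i ≤ 1 := fun i => by
    rw [← hl i]
    simpa [b.orthonormal.1 i] using setIntegral_norm_stft_sq_le hg_norm Ω (b i)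
  have htr : HasSum l (volume.real Ω) := by
    simpa only [hl] using hasSum_trace_locOp hg_norm hΩ b
  have hdef : HasSum (fun i => l i - l i ^ 2)
      (∫ z in Ω, (1 - ∫ w in Ω, ‖stft g g (w - z)‖ ^ 2)) := by
    have := hasSum_setIntegral_norm_stft_sq hg_norm hΩ b (c := fun i => 1 - l i)
      (G := fun z => 1 - ∫ w in Ω, ‖stft g g (w - z)‖ ^ 2)
      (fun i => abs_le.2 ⟨by linarith [hl1 i], by linarith [hl0 i]⟩)
      (fun z => by
        have h1 : HasSum (fun i => ‖stft g (b i) z‖ ^ 2) 1 := by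
          simpa only [inner_tfShift, norm_tfShift, hg_norm, one_pow] using
            b.hasSum_norm_inner_sq (tfShift g z)
        simpa only [sub_mul, one_mul] using h1.sub (hasSum_eigenvalue_mul_norm_stft_sq hΩ b hb z))
    simpa only [hl, sub_mul, one_mul, ← pow_two] using this
  -- The summable `l i` tend to 0 and `1 - δ > 0`.
  have hfin : {i | 1 - δ < l i}.Finite := by
    have h := htr.summable.tendsto_cofinite_zero.eventually
      (gt_mem_nhds (show (0 : ℝ) < 1 - δ by linarith [hδ.2]))
    refine (Filter.eventually_cofinite.1 h).subset fun i hi => ?_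
    exact not_lt.2 (le_of_lt hi)
  refine ⟨hfin.toFinset.card, b.eigenvalueCount_eq hsymm hb _ _ (by simp), ?_⟩
  have hcount : HasSum (fun i => if 1 - δ < l i then (1 : ℝ) else 0) hfin.toFinset.card := by
    have h : HasSum (fun i => if 1 - δ < l i then (1 : ℝ) else 0)
        (∑ i ∈ hfin.toFinset, if 1 - δ < l i then (1 : ℝ) else 0) :=
      hasSum_sum_of_ne_finset_zero fun i hi => if_neg (by simpa using hi)
    have e : ∑ i ∈ hfin.toFinset, (if 1 - δ < l i then (1 : ℝ) else 0) =
        hfin.toFinset.card := by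
      rw [Finset.sum_congr rfl fun i hi => if_pos (by simpa using hi)]
      simp
    rwa [e] at h
  have hdiff := hcount.sub htr
  calc |(hfin.toFinset.card : ℝ) - volume.real Ω|
      ≤ max (1 / δ) (1 / (1 - δ)) * ∫ z in Ω, (1 - ∫ w in Ω, ‖stft g g (w - z)‖ ^ 2) := by
        have h := hdef.mul_left (max (1 / δ) (1 / (1 - δ)))
        have hle : ∀ i, |(if 1 - δ < l i then (1 : ℝ) else 0) - l i| ≤
            max (1 / δ) (1 / (1 - δ)) * (l i - l i ^ 2) :=
          fun i => abs_threshold_sub_le hδ (hl0 i) (hl1 i)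
        exact abs_le.2 ⟨neg_le.1 (hasSum_le (fun i => (neg_le_abs _).trans (hle i)) hdiff.neg h),
          hasSum_le (fun i => (le_abs_self _).trans (hle i)) hdiff h⟩
    _ ≤ max (1 / δ) (1 / (1 - δ)) * (mStarNorm g ^ 2 * perimeter Ω) := by
        refine mul_le_mul_of_nonneg_left (setIntegral_one_sub_le hg_norm hg hΩ hΩ_per) ?_
        exact le_max_of_le_left (one_div_nonneg.2 hδ.1.le)
    _ = _ := (mul_assoc _ _ _).symm

end
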